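/- Let $K$ be a field of characteristic zero (for example $\mathbb{Q}$, $\mathbb{R}$ or $\mathbb{C}$). For $r\in\mathbb{Z}$ let $\mathcal{F}_r$ be the space of formal power series $\varphi\in K[[x]]$ such that $$\varphi\!\left(\frac{x}{x-1}\right)=(1-x)^r\varphi(x).$$ Let $E_n(x)$ be the Euler polynomials, defined by $\frac{2e^{xt}}{e^t+1}=\sum_{n\ge 0}E_n(x)\frac{t^n}{n!}$. For integers $n,i$ let ${n\brack i}$ be the coefficient of $x^{2i-1}$ in $x^{2n}-E_{2n}(x)$ if $1\le i\le n$, and ${n\brack i}=0$ otherwise; let ${n\brace i}$ be the coefficient of $x^{2i}$ in $x^{2n+1}-E_{2n+1}(x)$ if $0\le i\le n$, and ${n\brace i}=0$ otherwise. **Theorem.** Let $r\in\mathbb{Z}$ and $\varphi(x)=\sum_{i\ge 0}\gamma_i x^i\in K[[x]]$, and put $\gamma_i=0$ for $i<0$. Then $\varphi\in\mathcal{F}_r$ if and only if the following conditions hold. * If $r=2k$ is even, then for each integer $n\ge\max\{0,-k\}$, $$\gamma_{2n+1}=\sum_{i=-k}^{n}{n+k\brack i+k}\gamma_{2i},$$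 and, if $r<0$, then for $0\le n\le -k-1$, $$\gamma_{2n+1}=\sum_{i=0}^{n}-{-k-i\brack -k-n}\gamma_{2i}.$$ * If $r=2k+1$ is odd, then for each integer $n\ge\max\{0,-k\}$, $$\gamma_{2n+1}=\sum_{i=-k}^{n}{n+k\brace i+k}\gamma_{2i},$$ and, if $r<0$, then for $0\le n\le -k-1$, $$\gamma_{2n+1}=\sum_{i=0}^{n}-{-k-i-1\brace -k-n-1}\gamma_{2i}.$$ Moreover, for integers $n,i\ge 0$ set $${n\choose i}_r=\begin{cases}{r/2+n\brack r/2+i}, & r \text{ even},\ n\ge\max\{0,-r/2\},\\ -{-r/2-i\brack -r/2-n}, & r\text{ even},\ 0\le n<-r/2,\\ {(r-1)/2+n\brace (r-1)/2+i}, & r\text{ odd},\ n\ge\max\{0,-(r-1)/2\},\\ -{-(r+1)/2-i\brace -(r+1)/2-n}, & r\text{ odd},\ 0\le n<-(r-1)/2.\end{cases}$$ Then $\varphi\in\mathcal{F}_r$ if and only if for every $n\ge 0$, $$\gamma_{2n+1}=\sum_{i=0}^{n}{n\choose i}_r\gamma_{2i}.$$ -/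

import Mathlib

namespace OddFromEven

/-- The power series `1 - x`, as a unit of `K[[x]]` with inverse `1 + x + x^2 + ⋯`, so that the
powers `(1 - x)^r` make sense for all `r ∈ ℤ`. -/
noncomputable def oneSubX (K : Type*) [Field K] : (PowerSeries K)ˣ where
  val := 1 - PowerSeries.X
  inv := PowerSeries.mk 1
  val_inv := by rw [mul_comm]; exact PowerSeries.mk_one_mul_one_sub_eq_one K
  inv_val := PowerSeries.mk_one_mul_one_sub_eq_one K

/-- The power series `x / (x - 1)`. -/
noncomputable def moebius (K : Type*) [Field K] : PowerSeries K :=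
  PowerSeries.X * (PowerSeries.X - 1)⁻¹

theorem hasSubst_moebius (K : Type*) [Field K] : PowerSeries.HasSubst (moebius K) :=
  PowerSeries.HasSubst.of_constantCoeff_zero' (by simp [moebius])

/-- The space `F_r` of formal power series `φ` with `φ(x/(x-1)) = (1-x)^r φ(x)`. -/
noncomputable def F (K : Type*) [Field K] (r : ℤ) : Submodule K (PowerSeries K) where
  carrier := {φ | φ.subst (moebius K) = ((oneSubX K ^ r : (PowerSeries K)ˣ) : PowerSeries K) * φ}
  add_mem' {a b} ha hb := by
    simp only [Set.mem_ofPred_eq] at ha hb ⊢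
    rw [PowerSeries.subst_add (hasSubst_moebius K), ha, hb, mul_add]
  zero_mem' := by
    simp only [Set.mem_ofPred_eq, mul_zero]
    rw [← PowerSeries.coe_substAlgHom (hasSubst_moebius K), map_zero]
  smul_mem' c a ha := by
    simp only [Set.mem_ofPred_eq] at ha ⊢
    rw [PowerSeries.subst_smul (hasSubst_moebius K), ha, mul_smul_comm]

/-- The Euler polynomial `E_n(x)`: `n!` times the coefficient of `t^n` in
`2 e^{xt} / (e^t + 1)`, a power series in `t` over `ℚ[x]`. -/
noncomputable def eulerPoly (n : ℕ) : Polynomial ℚ :=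
  (n.factorial : Polynomial ℚ) * PowerSeries.coeff n
    (2 * PowerSeries.rescale (Polynomial.X : Polynomial ℚ) (PowerSeries.exp (Polynomial ℚ)) *
      PowerSeries.map Polynomial.C (PowerSeries.exp ℚ + 1)⁻¹)

/-- `[n, i]`: the coefficient of `x^{2i-1}` in `x^{2n} - E_{2n}(x)`; it is `0` unless
`1 ≤ i ≤ n`. -/
noncomputable def brack (n i : ℤ) : ℚ :=
  if 1 ≤ i ∧ i ≤ n then
    (Polynomial.X ^ (2 * n).toNat - eulerPoly (2 * n).toNat).coeff (2 * i - 1).toNat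
  else 0

/-- `{n, i}`: the coefficient of `x^{2i}` in `x^{2n+1} - E_{2n+1}(x)`; it is `0` unless
`0 ≤ i ≤ n`. -/
noncomputable def brace (n i : ℤ) : ℚ :=
  if 0 ≤ i ∧ i ≤ n then
    (Polynomial.X ^ (2 * n + 1).toNat - eulerPoly (2 * n + 1).toNat).coeff (2 * i).toNat
  else 0

/-- The unified coefficient `C(n, i)_r`. All the divisions by `2` below are exact. -/
noncomputable def unified (r : ℤ) (n i : ℕ) : ℚ :=
  if Even r then
    if max 0 (-(r / 2)) ≤ (n : ℤ) then brack (r / 2 + n) (r / 2 + i)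
    else -brack (-(r / 2) - i) (-(r / 2) - n)
  else
    if max 0 (-((r - 1) / 2)) ≤ (n : ℤ) then brace ((r - 1) / 2 + n) ((r - 1) / 2 + i)
    else -brace (-((r + 1) / 2) - i) (-((r + 1) / 2) - n)

/-- The coefficient `γ_i` of `φ = ∑ γ_i x^i`, with `γ_i = 0` for `i < 0`. -/
noncomputable def coeffZ {K : Type*} [Field K] (φ : PowerSeries K) (i : ℤ) : K :=
  if 0 ≤ i then PowerSeries.coeff i.toNat φ else 0

end OddFromEven

namespace OddFromEven

open PowerSeries Finset

/-! Let `D = x² d/dx + r x`. Since `D^p x^j = (j+r)⋯(j+r+p-1) x^(j+p)`, the series `twist r w φ` is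
`w(D) φ`, so `twist` is multiplicative in `w` (`twist_mul`). Let `σ` be `x ↦ -x`. As `exp(D)` sends
`φ(x)` to `(1-x)^(-r) φ(x/(1-x))`, membership in `F_r` says `exp(D) σφ = φ` (`mem_F_iff_twist`).

Take `E(t) = 2/(e^t+1)`, for which `E(-t) = E(t) e^t`. Since `σ D σ = -D`, `σ(E(D)φ) = E(-D) σφ =
E(D) exp(D) σφ`. As `E(D)` is invertible, `φ ∈ F_r` iff `E(D)φ` is even. Because `E - 1` is odd,
each vanishing odd coefficient of `E(D)φ` expresses `γ_(2n+1)` through the `γ_(2i)`, with the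
bracket numbers as coefficients (`unified_eq`). -/

/-- The falling factorial `a (a - 1) ⋯ (a - p + 1)` of an integer. -/
noncomputable def falling (a : ℤ) (p : ℕ) : ℤ := (descPochhammer ℤ p).eval a

theorem falling_eq_prod (a : ℤ) (p : ℕ) : falling a p = ∏ j ∈ range p, (a - j) :=
  descPochhammer_eval_eq_prod_range p a

theorem falling_add (a : ℤ) (p q : ℕ) :
    falling a (p + q) = falling a p * falling (a - p) q := by
  simp [falling, ← descPochhammer_mul]

theorem falling_zero (a : ℤ) : falling a 0 = 1 := by simp [falling]

theorem falling_eq_zero {a : ℤ} {p : ℕ} (h0 : 0 ≤ a) (h : a < p) : falling a p = 0 := by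
  lift a to ℕ using h0
  exact descPochhammer_eval_coe_nat_of_lt (by exact_mod_cast h)

/-- For odd `p` this yields the minus sign and the reversed indices of the negative-`r` formulas. -/
theorem falling_reflect (a : ℤ) (p : ℕ) :
    falling a p = (-1) ^ p * falling (p - 1 - a) p := by
  rw [falling_eq_prod, falling_eq_prod, ← prod_range_reflect, ← card_range p, ← prod_const,
    card_range, ← prod_mul_distrib]
  refine prod_congr rfl fun j hj => ?_
  have := mem_range.1 hj
  rw [Nat.sub_sub, Nat.cast_sub (by omega)]
  push_cast
  ring

theorem falling_eq_factorial_mul_choose (a : ℤ) (p : ℕ) :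
    falling a p = p.factorial * Ring.choose a p := by
  rw [falling, Polynomial.eval_eq_smeval, Ring.descPochhammer_eq_factorial_smul_choose,
    nsmul_eq_mul]

theorem falling_natCast (n i : ℕ) :
    (falling (n + i : ℕ) n : ℤ) * i.factorial = (n + i).factorial := by
  rw [falling, descPochhammer_eval_eq_descFactorial]
  have := Nat.factorial_mul_descFactorial (Nat.le_add_right n i)
  rw [Nat.add_sub_cancel_left] at this
  rw [mul_comm]
  exact_mod_cast this

/-! ### The generating series of the values `E_n(0)` -/

section Euler

variable (K : Type*) [Field K] [CharZero K]

/-- The exponential generating series `2 / (e^t + 1)` of the numbers `E_n(0)`. -/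
noncomputable def eulerSeries : PowerSeries K := 2 * (exp K + 1)⁻¹

theorem eulerSeries_mul : eulerSeries K * (exp K + 1) = 2 := by
  rw [eulerSeries, mul_assoc, PowerSeries.inv_mul_cancel, mul_one]
  simp [one_add_one_eq_two]

theorem exp_add_one_ne_zero : exp K + 1 ≠ 0 := fun h => by
  have := congrArg constantCoeff h
  simp [one_add_one_eq_two] at this

theorem eulerSeries_neg : rescale (-1 : K) (eulerSeries K) = eulerSeries K * exp K := by
  have h1 := congrArg (rescale (-1 : K)) (eulerSeries_mul K)
  rw [map_mul, map_add, map_one, map_ofNat] at h1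
  have h2 : exp K * rescale (-1 : K) (exp K) = 1 := exp_mul_exp_neg_eq_one
  have h3 := eulerSeries_mul K
  refine mul_right_cancel₀ (exp_add_one_ne_zero K) ?_
  linear_combination exp K * h1 - rescale (-1 : K) (eulerSeries K) * h2 - exp K * h3

theorem eulerSeries_add_neg : eulerSeries K + rescale (-1 : K) (eulerSeries K) = 2 := by
  rw [eulerSeries_neg, ← eulerSeries_mul K]
  ring

omit [CharZero K] in
theorem coeff_two (n : ℕ) : coeff n (2 : PowerSeries K) = if n = 0 then 2 else 0 := by
  rw [← map_ofNat (C (R := K)) 2, coeff_C]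

theorem coeff_zero_eulerSeries : coeff 0 (eulerSeries K) = 1 := by
  have := congrArg (coeff 0) (eulerSeries_add_neg K)
  rw [map_add, coeff_rescale, coeff_two, if_pos rfl] at this
  linear_combination this / 2

theorem coeff_eulerSeries_of_even {n : ℕ} (h : Even n) (h0 : n ≠ 0) :
    coeff n (eulerSeries K) = 0 := by
  have := congrArg (coeff n) (eulerSeries_add_neg K)
  rw [map_add, coeff_rescale, coeff_two, if_neg h0, h.neg_one_pow] at this
  linear_combination this / 2

theorem map_eulerSeries : PowerSeries.map (algebraMap ℚ K) (eulerSeries ℚ) = eulerSeries K := by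
  refine mul_right_cancel₀ (exp_add_one_ne_zero K) ?_
  have := congrArg (PowerSeries.map (algebraMap ℚ K)) (eulerSeries_mul ℚ)
  rwa [map_mul, map_add, map_exp, map_one, map_ofNat, ← eulerSeries_mul K] at this

theorem coeff_eulerSeries_cast (n : ℕ) :
    ((coeff n (eulerSeries ℚ) : ℚ) : K) = coeff n (eulerSeries K) := by
  rw [← map_eulerSeries K, coeff_map, eq_ratCast]

end Euler

/-! ### Bracket numbers as falling factorials times Euler coefficients -/

theorem coeff_X_pow_sub_eulerPoly (p i : ℕ) (hp : p ≠ 0) :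
    (Polynomial.X ^ (p + i) - eulerPoly (p + i)).coeff i =
      -(falling (p + i : ℕ) p * coeff p (eulerSeries ℚ)) := by
  have h2 : (2 : PowerSeries (Polynomial ℚ)) = PowerSeries.map Polynomial.C 2 := by
    rw [map_ofNat]
  have h : eulerPoly (p + i) = ∑ x ∈ antidiagonal (p + i),
      Polynomial.C (((p + i).factorial : ℚ) * (1 / x.1.factorial) * coeff x.2 (eulerSeries ℚ)) *
        Polynomial.X ^ x.1 := by
    rw [eulerPoly, mul_comm 2, mul_assoc, h2, ← map_mul,
      show 2 * (exp ℚ + 1)⁻¹ = eulerSeries ℚ from rfl, coeff_mul, mul_sum]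
    refine sum_congr rfl fun x _ => ?_
    rw [coeff_rescale, coeff_exp, coeff_map, map_mul, map_mul, map_natCast]
    simp only [Polynomial.algebraMap_eq]
    ring
  have hf : (falling (p + i : ℕ) p : ℚ) * i.factorial = (p + i).factorial := by
    exact_mod_cast falling_natCast p i
  rw [Polynomial.coeff_sub, Polynomial.coeff_X_pow, if_neg (by omega), h,
    Polynomial.finsetSum_coeff, sum_eq_single (i, p)]
  · rw [Polynomial.coeff_C_mul, Polynomial.coeff_X_pow, if_pos rfl, ← hf]
    have := i.factorial_ne_zero
    field_simp
    ring
  · intro x hx hne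
    rw [Polynomial.coeff_C_mul, Polynomial.coeff_X_pow, if_neg, mul_zero]
    rintro rfl
    rw [HasAntidiagonal.mem_antidiagonal] at hx
    exact hne (Prod.ext rfl (by simp; omega))
  · intro hx
    exact absurd (HasAntidiagonal.mem_antidiagonal.2 (add_comm _ _)) hx

theorem brack_eq {n i : ℤ} (hn : 0 ≤ n) (p : ℕ) (hp : (p : ℤ) = 2 * (n - i) + 1) :
    brack n i = -(falling (2 * n) p * coeff p (eulerSeries ℚ)) := by
  by_cases hi : 1 ≤ i
  · rw [brack, if_pos ⟨hi, by omega⟩, show (2 * n).toNat = p + (2 * i - 1).toNat by omega,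
      coeff_X_pow_sub_eulerPoly _ _ (by omega)]
    congr 4
    omega
  -- Here `p > 2n`, so the falling factorial passes through `0`, in agreement with the zero
  -- convention.
  · rw [brack, if_neg (by omega), falling_eq_zero (by omega) (by omega)]
    simp

theorem brace_eq {n i : ℤ} (hn : 0 ≤ n) (p : ℕ) (hp : (p : ℤ) = 2 * (n - i) + 1) :
    brace n i = -(falling (2 * n + 1) p * coeff p (eulerSeries ℚ)) := by
  by_cases hi : 0 ≤ i
  · rw [brace, if_pos ⟨hi, by omega⟩, show (2 * n + 1).toNat = p + (2 * i).toNat by omega,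
      coeff_X_pow_sub_eulerPoly _ _ (by omega)]
    congr 4
    omega
  · rw [brace, if_neg (by omega), falling_eq_zero (by omega) (by omega)]
    simp

theorem unified_eq (r : ℤ) {n i : ℕ} (hi : i ≤ n) :
    unified r n i = -(falling (2 * n + r) (2 * n + 1 - 2 * i) *
      coeff (2 * n + 1 - 2 * i) (eulerSeries ℚ)) := by
  obtain ⟨k, rfl | rfl⟩ := Int.even_or_odd' r
  · rw [unified, if_pos (even_two_mul k), Int.mul_ediv_cancel_left _ two_ne_zero]
    split_ifs with h
    · rw [brack_eq (by omega) (2 * n + 1 - 2 * i) (by omega)]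
      rw [mul_add, add_comm (2 * k)]
    · rw [brack_eq (by omega) (2 * n + 1 - 2 * i) (by omega), falling_reflect (2 * n + 2 * k),
        Odd.neg_one_pow ⟨n - i, by omega⟩]
      rw [show ((2 * n + 1 - 2 * i : ℕ) : ℤ) - 1 - (2 * n + 2 * k) = 2 * (-k - i) by omega]
      push_cast
      ring
  · rw [unified, if_neg (by simp), add_sub_cancel_right, Int.mul_ediv_cancel_left _ two_ne_zero,
      show (2 * k + 1 + 1) / 2 = k + 1 by omega]
    split_ifs with h
    · rw [brace_eq (by omega) (2 * n + 1 - 2 * i) (by omega)]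
      rw [show 2 * (k + n) + 1 = 2 * n + (2 * k + 1) by ring]
    · rw [brace_eq (by omega) (2 * n + 1 - 2 * i) (by omega),
        falling_reflect (2 * n + (2 * k + 1)), Odd.neg_one_pow ⟨n - i, by omega⟩]
      rw [show ((2 * n + 1 - 2 * i : ℕ) : ℤ) - 1 - (2 * n + (2 * k + 1)) =
        2 * (-(k + 1) - i) + 1 by omega]
      push_cast
      ring

/-! ### The action of power series in `D` -/

section Twist

variable {K : Type*} [Field K]

/-- The action of `w` on power series with `m`-th coefficient
`∑ (m + r - 1) ⋯ (m + r - p) w_p γ_j` over `p + j = m`. -/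
noncomputable def twist (r : ℤ) (w φ : PowerSeries K) : PowerSeries K :=
  mk fun m => ∑ x ∈ antidiagonal m,
    (falling (m + r - 1) x.1 : K) * coeff x.1 w * coeff x.2 φ

theorem coeff_twist (r : ℤ) (w φ : PowerSeries K) (m : ℕ) :
    coeff m (twist r w φ) = ∑ x ∈ antidiagonal m,
      (falling (m + r - 1) x.1 : K) * coeff x.1 w * coeff x.2 φ :=
  coeff_mk _ _

/-- This is `D^(p+q) = D^p D^q`; on coefficients it reduces to `falling_add` after reindexing
triples. -/
theorem twist_mul (r : ℤ) (w v φ : PowerSeries K) :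
    twist r (w * v) φ = twist r w (twist r v φ) := by
  ext m
  simp only [coeff_twist, coeff_mul, mul_sum, sum_mul, sum_sigma']
  refine sum_nbij' (fun x => ⟨(x.2.1, x.2.2 + x.1.2), (x.2.2, x.1.2)⟩)
    (fun x => ⟨(x.1.1 + x.2.1, x.2.2), (x.1.1, x.2.1)⟩) ?_ ?_ ?_ ?_ ?_
  · rintro ⟨⟨a, b⟩, c, d⟩ h
    simp only [mem_sigma, HasAntidiagonal.mem_antidiagonal, and_true] at h ⊢
    obtain ⟨rfl, rfl⟩ := h
    ring
  · rintro ⟨⟨a, b⟩, c, d⟩ h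
    simp only [mem_sigma, HasAntidiagonal.mem_antidiagonal, and_true] at h ⊢
    obtain ⟨rfl, rfl⟩ := h
    ring
  · rintro ⟨⟨a, b⟩, c, d⟩ h
    simp only [mem_sigma, HasAntidiagonal.mem_antidiagonal] at h
    obtain ⟨rfl, rfl⟩ := h
    rfl
  · rintro ⟨⟨a, b⟩, c, d⟩ h
    simp only [mem_sigma, HasAntidiagonal.mem_antidiagonal] at h
    obtain ⟨rfl, rfl⟩ := h
    rfl
  · rintro ⟨⟨a, b⟩, c, d⟩ h
    simp only [mem_sigma, HasAntidiagonal.mem_antidiagonal] at h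
    obtain ⟨rfl, rfl⟩ := h
    simp only [falling_add]
    rw [show ((d + b : ℕ) : ℤ) + r - 1 = ((c + d + b : ℕ) : ℤ) + r - 1 - c by push_cast; ring]
    push_cast
    ring

theorem twist_one (r : ℤ) (φ : PowerSeries K) : twist r 1 φ = φ := by
  ext m
  rw [coeff_twist, sum_eq_single (0, m)]
  · simp [falling_zero]
  · intro x hx hne
    rw [coeff_one, if_neg, mul_zero, zero_mul]
    intro h0
    rw [HasAntidiagonal.mem_antidiagonal] at hx
    exact hne (Prod.ext h0 (by simp; omega))
  · simp

theorem rescale_twist (r : ℤ) (c : K) (w φ : PowerSeries K) :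
    rescale c (twist r w φ) = twist r (rescale c w) (rescale c φ) := by
  ext m
  simp only [coeff_rescale, coeff_twist, mul_sum]
  refine sum_congr rfl fun x hx => ?_
  rw [← HasAntidiagonal.mem_antidiagonal.1 hx, pow_add]
  ring

theorem twist_injective (r : ℤ) {w : PowerSeries K} (hw : constantCoeff w ≠ 0) :
    Function.Injective (twist r w) := fun φ ψ h => by
  simpa only [← twist_mul, PowerSeries.inv_mul_cancel w hw, twist_one] using
    congrArg (twist r w⁻¹) h

end Twist

/-! ### The substitution `x/(x-1)` as `exp(D) σ` -/

section Membership

variable {K : Type*} [Field K]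

theorem oneSubX_zpow (N : ℤ) :
    ((oneSubX K ^ N : (PowerSeries K)ˣ) : PowerSeries K) =
      rescale (-1 : K) (binomialSeries K N) := by
  have h1 : rescale (-1 : K) (binomialSeries K (1 : ℤ)) = (oneSubX K : PowerSeries K) := by
    have := binomialSeries_nat (R := ℤ) (A := K) 1
    rw [Nat.cast_one, pow_one] at this
    rw [this, map_add, map_one, rescale_X]
    simp [oneSubX, sub_eq_add_neg]
  have hs (N : ℤ) : rescale (-1 : K) (binomialSeries K (N + 1)) =
      rescale (-1 : K) (binomialSeries K N) * (oneSubX K : PowerSeries K) := by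
    rw [binomialSeries_add, map_mul, h1]
  induction N using Int.induction_on with
  | zero => simp
  | succ n ih => rw [zpow_add_one, Units.val_mul, ih, hs]
  | pred n ih =>
    rw [zpow_sub_one, Units.val_mul, ih, Units.mul_inv_eq_iff_eq_mul, ← hs, sub_add_cancel]

theorem coeff_oneSubX_zpow_neg [CharZero K] (N : ℤ) (p : ℕ) :
    coeff p ((oneSubX K ^ (-N) : (PowerSeries K)ˣ) : PowerSeries K) =
      (falling (N + p - 1) p : K) * coeff p (exp K) := by
  rw [oneSubX_zpow, coeff_rescale, binomialSeries_coeff, falling_reflect,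
    show (p : ℤ) - 1 - (N + p - 1) = -N by ring, falling_eq_factorial_mul_choose, coeff_exp]
  have := p.factorial_ne_zero
  push_cast
  simp only [zsmul_eq_mul, mul_one]
  field_simp

theorem moebius_pow (d : ℕ) :
    moebius K ^ d =
      X ^ d * ((-1) ^ d * ((oneSubX K ^ (-d : ℤ) : (PowerSeries K)ˣ) : PowerSeries K)) := by
  have h : moebius K = X * (-1 * (((oneSubX K)⁻¹ : (PowerSeries K)ˣ) : PowerSeries K)) := by
    rw [moebius, PowerSeries.inv_eq_iff_mul_eq_one (by simp) |>.2]
    have : (((oneSubX K)⁻¹ : (PowerSeries K)ˣ) : PowerSeries K) * (1 - X : PowerSeries K) = 1 :=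
      (oneSubX K).inv_mul
    linear_combination this
  rw [h, mul_pow, mul_pow, zpow_neg, zpow_natCast, ← inv_pow, Units.val_pow_eq_pow_val]

/-- `X^d` divides `moebius K ^ d`, so terms with `d > m` do not contribute; the substitution becomes
a finite sum. -/
theorem coeff_subst_moebius {l m : ℕ} (h : l ≤ m) (φ : PowerSeries K) :
    coeff l (φ.subst (moebius K)) =
      coeff l (∑ d ∈ range (m + 1), C (coeff d φ) * moebius K ^ d) := by
  rw [coeff_subst' (hasSubst_moebius K), map_sum, finsum_eq_sum_of_support_subset]
  · exact sum_congr rfl fun d _ => by rw [coeff_C_mul, smul_eq_mul]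
  · intro d hd
    by_contra hdm
    refine hd ?_
    simp only [coe_range, Set.mem_Iio] at hdm
    simp only
    rw [moebius_pow, coeff_X_pow_mul', if_neg (by omega), smul_zero]

theorem oneSubX_zpow_mul_subst [CharZero K] (r : ℤ) (φ : PowerSeries K) :
    ((oneSubX K ^ (-r) : (PowerSeries K)ˣ) : PowerSeries K) * φ.subst (moebius K) =
      twist r (exp K) (rescale (-1) φ) := by
  ext m
  have h : coeff m (((oneSubX K ^ (-r) : (PowerSeries K)ˣ) : PowerSeries K) *
      φ.subst (moebius K)) = coeff m (((oneSubX K ^ (-r) : (PowerSeries K)ˣ) : PowerSeries K) *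
        ∑ d ∈ range (m + 1), C (coeff d φ) * moebius K ^ d) := by
    rw [coeff_mul, coeff_mul]
    refine sum_congr rfl fun x hx => ?_
    rw [coeff_subst_moebius (Nat.le.intro (add_comm _ _ |>.trans (HasAntidiagonal.mem_antidiagonal.1 hx)))]
  rw [h, mul_sum, map_sum, coeff_twist, ← Nat.sum_antidiagonal_swap,
    Nat.sum_antidiagonal_eq_sum_range_succ_mk]
  refine sum_congr rfl fun d hd => ?_
  have hd : d ≤ m := Nat.lt_succ_iff.1 (mem_range.1 hd)
  -- By linearity only `x^d` matters: its image is `(-1)^d x^d (1-x)^(-(d+r))`, whose coefficients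
  -- are those of `exp(D)` on `(-x)^d`.
  have e : ((oneSubX K ^ (-r) : (PowerSeries K)ˣ) : PowerSeries K) *
      (C (coeff d φ) * moebius K ^ d) = C ((-1) ^ d * coeff d φ) *
        (X ^ d * ((oneSubX K ^ (-(d + r)) : (PowerSeries K)ˣ) : PowerSeries K)) := by
    rw [moebius_pow, neg_add, zpow_add, Units.val_mul]
    simp only [map_mul, map_pow, map_neg, map_one]
    ring
  rw [e, coeff_C_mul, coeff_X_pow_mul', if_pos hd, coeff_oneSubX_zpow_neg, coeff_rescale]
  simp only [Prod.swap]
  rw [show (d : ℤ) + r + (m - d : ℕ) - 1 = m + r - 1 by omega]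
  ring

theorem mem_F_iff_twist [CharZero K] (r : ℤ) (φ : PowerSeries K) :
    φ ∈ F K r ↔ twist r (exp K) (rescale (-1) φ) = φ := by
  rw [← oneSubX_zpow_mul_subst, zpow_neg, Units.inv_mul_eq_iff_eq_mul]
  rfl

end Membership

/-! ### The parity criterion and the explicit relations -/

section Main

variable {K : Type*} [Field K] [CharZero K]

theorem rescale_neg_one_eq_self_iff (φ : PowerSeries K) :
    rescale (-1 : K) φ = φ ↔ ∀ n : ℕ, coeff (2 * n + 1) φ = 0 := by
  constructor
  · intro h n
    have := congrArg (coeff (2 * n + 1)) h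
    rw [coeff_rescale, (odd_two_mul_add_one n).neg_one_pow, neg_one_mul] at this
    linear_combination -this / 2
  · intro h
    ext m
    rw [coeff_rescale]
    obtain ⟨n, rfl | rfl⟩ := Nat.even_or_odd' m
    · rw [(even_two_mul n).neg_one_pow, one_mul]
    · rw [h, mul_zero]

theorem mem_F_iff_coeff_twist_eulerSeries (r : ℤ) (φ : PowerSeries K) :
    φ ∈ F K r ↔ ∀ n : ℕ, coeff (2 * n + 1) (twist r (eulerSeries K) φ) = 0 := by
  have h0 : constantCoeff (eulerSeries K) ≠ 0 := by
    rw [← coeff_zero_eq_constantCoeff_apply, coeff_zero_eulerSeries]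
    exact one_ne_zero
  rw [mem_F_iff_twist, ← rescale_neg_one_eq_self_iff, rescale_twist, eulerSeries_neg, twist_mul,
    (twist_injective r h0).eq_iff]

theorem coeff_twist_eulerSeries (r : ℤ) (φ : PowerSeries K) (n : ℕ) :
    coeff (2 * n + 1) (twist r (eulerSeries K) φ) = coeff (2 * n + 1) φ -
      ∑ i ∈ range (n + 1), (unified r n i : K) * coeff (2 * i) φ := by
  rw [coeff_twist, ← Nat.sum_antidiagonal_swap, Nat.sum_antidiagonal_eq_sum_range_succ_mk,
    -- The split-off term is `j = 2n+1`, `p = 0`, contributing `γ_(2n+1)`.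
    sum_range_succ, sub_eq_neg_add (coeff (2 * n + 1) φ), ← sum_neg_distrib]
  congr 1
  · rw [← sum_subset (s₁ := (range (n + 1)).image (2 * ·))]
    · rw [sum_image (fun a _ b _ h => by simpa using h)]
      refine sum_congr rfl fun i hi => ?_
      rw [unified_eq r (Nat.lt_succ_iff.1 (mem_range.1 hi)), ← coeff_eulerSeries_cast,
        Prod.fst_swap, Prod.snd_swap,
        show ((2 * n + 1 : ℕ) : ℤ) + r - 1 = 2 * n + r by push_cast; ring]
      push_cast
      ring
    · intro i
      simp only [mem_image, mem_range]
      omega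
    -- For odd `i < 2n+1` the index `2n+1-i` is even and positive, where `E` has no coefficient.
    · intro i hi hne
      simp only [mem_image, mem_range, not_exists, not_and] at hi hne
      have h2 : ¬ Even i := fun ⟨j, hj⟩ => hne j (by omega) (by omega)
      rw [Nat.not_even_iff_odd] at h2
      simp only [Prod.swap]
      rw [coeff_eulerSeries_of_even K _ (by omega), mul_zero, zero_mul]
      exact Nat.Odd.sub_odd (odd_two_mul_add_one n) h2
  · simp [falling_zero, coeff_zero_eulerSeries, -coeff_zero_eq_constantCoeff]

theorem mem_F_iff_unified (r : ℤ) (φ : PowerSeries K) :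
    φ ∈ F K r ↔ ∀ n : ℕ, coeff (2 * n + 1) φ =
      ∑ i ∈ range (n + 1), (unified r n i : K) * coeff (2 * i) φ := by
  simp only [mem_F_iff_coeff_twist_eulerSeries, coeff_twist_eulerSeries, sub_eq_zero]

omit [CharZero K] in
/-- Terms with index below `max 0 (-k)` vanish, so a sum over `-k ≤ i ≤ n` in `ℤ` may be taken
over `0 ≤ i ≤ n` in `ℕ`. -/
theorem sum_Icc_coeffZ_eq_sum_range (f : ℤ → ℚ) (k : ℤ) (hf : ∀ i < -k, f i = 0)
    (φ : PowerSeries K) (n : ℕ) :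
    ∑ i ∈ Icc (-k) (n : ℤ), (f i : K) * coeffZ φ (2 * i) =
      ∑ i ∈ range (n + 1), (f i : K) * coeff (2 * i) φ := by
  have h : ∑ i ∈ range (n + 1), (f i : K) * coeff (2 * i) φ =
      ∑ i ∈ Icc (0 : ℤ) n, (f i : K) * coeffZ φ (2 * i) := by
    refine sum_nbij' (fun i => (i : ℤ)) Int.toNat ?_ ?_ ?_ ?_ ?_
    · intro i hi
      simp only [mem_range, mem_Icc] at hi ⊢
      omega
    · intro i hi
      simp only [mem_range, mem_Icc] at hi ⊢
      omega
    · intro i _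
      simp
    · intro i hi
      simp only [mem_Icc] at hi
      omega
    · intro i _
      rw [coeffZ, if_pos (by omega), show (2 * (i : ℤ)).toNat = 2 * i by omega]
  rw [h]
  rw [← sum_subset (Icc_subset_Icc_left (le_max_left (-k) 0)),
    ← sum_subset (Icc_subset_Icc_left (le_max_right (-k) 0))]
  · intro i hi hne
    simp only [mem_Icc] at hi hne
    rw [hf i (by omega), Rat.cast_zero, zero_mul]
  · intro i hi hne
    simp only [mem_Icc] at hi hne
    rw [coeffZ, if_neg (by omega), mul_zero]

end Main

end OddFromEven

theorem mainTheorem3 (K : Type*) [Field K] [CharZero K] (r : ℤ) (φ : PowerSeries K) :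
    (φ ∈ OddFromEven.F K r ↔
      (∀ k : ℤ, r = 2 * k →
        (∀ n : ℕ, max 0 (-k) ≤ (n : ℤ) →
          PowerSeries.coeff (2 * n + 1) φ =
            ∑ i ∈ Finset.Icc (-k) (n : ℤ),
              (OddFromEven.brack (n + k) (i + k) : K) * OddFromEven.coeffZ φ (2 * i)) ∧
        (r < 0 → ∀ n : ℕ, (n : ℤ) ≤ -k - 1 →
          PowerSeries.coeff (2 * n + 1) φ =
            ∑ i ∈ Finset.range (n + 1),
              -(OddFromEven.brack (-k - i) (-k - n) : K) * PowerSeries.coeff (2 * i) φ)) ∧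
      (∀ k : ℤ, r = 2 * k + 1 →
        (∀ n : ℕ, max 0 (-k) ≤ (n : ℤ) →
          PowerSeries.coeff (2 * n + 1) φ =
            ∑ i ∈ Finset.Icc (-k) (n : ℤ),
              (OddFromEven.brace (n + k) (i + k) : K) * OddFromEven.coeffZ φ (2 * i)) ∧
        (r < 0 → ∀ n : ℕ, (n : ℤ) ≤ -k - 1 →
          PowerSeries.coeff (2 * n + 1) φ =
            ∑ i ∈ Finset.range (n + 1),
              -(OddFromEven.brace (-k - i - 1) (-k - n - 1) : K) *
                PowerSeries.coeff (2 * i) φ))) ∧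
    (φ ∈ OddFromEven.F K r ↔
      ∀ n : ℕ, PowerSeries.coeff (2 * n + 1) φ =
        ∑ i ∈ Finset.range (n + 1),
          (OddFromEven.unified r n i : K) * PowerSeries.coeff (2 * i) φ) := by
  refine ⟨?_, OddFromEven.mem_F_iff_unified r φ⟩
  rw [OddFromEven.mem_F_iff_unified]
  have hbrack (k : ℤ) (n : ℕ) := OddFromEven.sum_Icc_coeffZ_eq_sum_range (K := K)
    (fun i => OddFromEven.brack (n + k) (i + k)) k
    (fun i hi => by rw [OddFromEven.brack, if_neg (by omega)]) φ n
  have hbrace (k : ℤ) (n : ℕ) := OddFromEven.sum_Icc_coeffZ_eq_sum_range (K := K)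
    (fun i => OddFromEven.brace (n + k) (i + k)) k
    (fun i hi => by rw [OddFromEven.brace, if_neg (by omega)]) φ n
  simp only [hbrack, hbrace]
  obtain ⟨k, rfl | rfl⟩ := Int.even_or_odd' r
  · have hpos (n i : ℕ) (h : max 0 (-k) ≤ (n : ℤ)) :
        OddFromEven.unified (2 * k) n i = OddFromEven.brack (n + k) (i + k) := by
      rw [OddFromEven.unified, if_pos (even_two_mul k), Int.mul_ediv_cancel_left _ two_ne_zero,
        if_pos h, add_comm k, add_comm k]
    have hneg (n i : ℕ) (h : ¬ max 0 (-k) ≤ (n : ℤ)) :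
        OddFromEven.unified (2 * k) n i = -OddFromEven.brack (-k - i) (-k - n) := by
      rw [OddFromEven.unified, if_pos (even_two_mul k), Int.mul_ediv_cancel_left _ two_ne_zero,
        if_neg h]
    constructor
    · refine fun H => ⟨fun l hl => ?_, fun l hl => by omega⟩
      obtain rfl : k = l := by omega
      refine ⟨fun n hn => ?_, fun _ n hn => ?_⟩
      · simpa only [hpos n _ hn] using H n
      · simpa only [hneg n _ (by omega), Rat.cast_neg] using H n
    · intro H n
      obtain ⟨h1, h2⟩ := H.1 k rfl
      by_cases hn : max 0 (-k) ≤ (n : ℤ)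
      · simpa only [hpos n _ hn] using h1 n hn
      · simpa only [hneg n _ hn, Rat.cast_neg] using h2 (by omega) n (by omega)
  · have hpos (n i : ℕ) (h : max 0 (-k) ≤ (n : ℤ)) :
        OddFromEven.unified (2 * k + 1) n i = OddFromEven.brace (n + k) (i + k) := by
      rw [OddFromEven.unified, if_neg (by simp), add_sub_cancel_right,
        Int.mul_ediv_cancel_left _ two_ne_zero, if_pos h, add_comm k, add_comm k]
    have hneg (n i : ℕ) (h : ¬ max 0 (-k) ≤ (n : ℤ)) :
        OddFromEven.unified (2 * k + 1) n i =
          -OddFromEven.brace (-k - i - 1) (-k - n - 1) := by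
      rw [OddFromEven.unified, if_neg (by simp), add_sub_cancel_right,
        Int.mul_ediv_cancel_left _ two_ne_zero, if_neg h,
        show (2 * k + 1 + 1) / 2 = k + 1 by omega]
      congr 2 <;> ring
    constructor
    · refine fun H => ⟨fun l hl => by omega, fun l hl => ?_⟩
      obtain rfl : k = l := by omega
      refine ⟨fun n hn => ?_, fun _ n hn => ?_⟩
      · simpa only [hpos n _ hn] using H n
      · simpa only [hneg n _ (by omega), Rat.cast_neg] using H n
    · intro H n
      obtain ⟨h1, h2⟩ := H.2 k rfl
      by_cases hn : max 0 (-k) ≤ (n : ℤ)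
      · simpa only [hpos n _ hn] using h1 n hn
      · simpa only [hneg n _ hn, Rat.cast_neg] using h2 (by omega) n (by omega)
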